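/- Let $M$ be a Poisson manifold, i.e. a smooth (Hausdorff, second countable, finite-dimensional, real) manifold with a Poisson bracket $\{\cdot,\cdot\}$ on $C^\infty(M,\mathbb{R})$, extended complex-bilinearly to $\mathcal{A}=C^\infty(M,\mathbb{C})$. Let $P_0\in M_n(\mathcal{A})$ be a projection ($P_0^2=P_0=P_0^*$), let $E\subseteq M\times\mathbb{C}^n$ be its image, so that $\mathcal{E}:=\Gamma^\infty(E)=P_0\mathcal{A}^n$, and put $$\{x,a\}_{\mathcal{E}}:=P_0\{x,a\}\qquad(x\in\mathcal{E},\ a\in\mathcal{A}),$$ where $\{x,a\}$ is taken componentwise. Let $\nabla:=P_0\circ d$ be the Levi-Civita connection of $E$, where $d$ is componentwise exterior differentiation. A bilinear bracket $\{\cdot,\cdot\}_{\mathcal{E}}:\mathcal{E}\times\mathcal{A}\to\mathcal{E}$ makes $\mathcal{E}$ a Poisson module if, for all $x\in\mathcal{E}$ and $a,b\in\mathcal{A}$, $$\{xa,b\}_{\mathcal{E}}=\{x,b\}_{\mathcal{E}}\,a+x\{a,b\},\qquad \{x,ab\}_{\mathcal{E}}=\{x,a\}_{\mathcal{E}}\,b+\{x,b\}_{\mathcal{E}}\,a,$$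 $$\{x,\{a,b\}\}_{\mathcal{E}}=\{\{x,a\}_{\mathcal{E}},b\}_{\mathcal{E}}-\{\{x,b\}_{\mathcal{E}},a\}_{\mathcal{E}}.$$ For $f\in C^\infty(M,\mathbb{R})$ the Hamiltonian vector field $X_f$ is given by $X_f h=\{h,f\}$. The symplectic leaves of $M$ are the equivalence classes of points that can be joined by piecewise Hamiltonian curves; the tangent space at $p$ of the leaf through $p$ is $\{X_f(p): f\in C^\infty(M,\mathbb{R})\}$. The connection $\nabla$ is flat on a leaf $L$ if its restriction to $L$ has zero curvature, i.e. if for all vector fields $X,Y$ tangent to $L$ along $L$ and all $x\in\Gamma^\infty(E)$, $$\nabla_X\nabla_Yx-\nabla_Y\nabla_Xx-\nabla_{[X,Y]}x=0\quad\text{at all points of }L.$$ Then $(\mathcal{E},\{\cdot,\cdot\}_{\mathcal{E}})$ is a Poisson module if and only if $\nabla$ is flat on each symplectic leaf of $M$. -/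

import Mathlib

open scoped Manifold ContDiff Matrix

noncomputable section

namespace PoissonGeometry

section Algebra

/-- A Poisson bracket on a commutative `k`-algebra `A`: a Lie bracket that is a derivation in each
argument. -/
structure PoissonBracket (k A : Type*) [CommRing k] [CommRing A] [Algebra k A] where
  bracket : A →ₗ[k] A →ₗ[k] A
  skew : ∀ a b, bracket a b = -bracket b a
  leibniz : ∀ a b c, bracket (a * b) c = a * bracket b c + bracket a c * b
  jacobi : ∀ a b c,
    bracket a (bracket b c) + bracket b (bracket c a) + bracket c (bracket a b) = 0

/-- `(𝓔, br)` is a (right) Poisson module over the Poisson algebra `(A, pb)`: the bracket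
`br : 𝓔 × A → 𝓔` is `k`-bilinear, satisfies the two Leibniz rules, and is a representation of the
Lie algebra `(A, pb)`. (For `k = ℝ` and `A = C^∞(M, ℂ)` the Leibniz rules make `br` complex-bilinear
as well, since `{i, b} = 0` and `br x i = 0`. As `A` is commutative, right `A`-modules are written as left modules.) -/
structure IsPoissonModule {k A 𝓔 : Type*} [CommRing k] [CommRing A] [Algebra k A]
    [AddCommGroup 𝓔] [Module A 𝓔] [Module k 𝓔]
    (pb : PoissonBracket k A) (br : 𝓔 → A → 𝓔) : Prop where
  add_left : ∀ x y a, br (x + y) a = br x a + br y a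
  smul_left : ∀ (c : k) x a, br (c • x) a = c • br x a
  add_right : ∀ x a b, br x (a + b) = br x a + br x b
  smul_right : ∀ (c : k) x a, br x (c • a) = c • br x a
  leibniz_left : ∀ x a b, br (a • x) b = a • br x b + pb.bracket a b • x
  leibniz_right : ∀ x a b, br x (a * b) = b • br x a + a • br x b
  lie : ∀ x a b, br x (pb.bracket a b) = br (br x a) b - br (br x b) a

end Algebra

variable {m : ℕ} {M : Type*} [TopologicalSpace M] [ChartedSpace (EuclideanSpace ℝ (Fin m)) M]

section Functions

/-- `ℂ` is a smooth ring over `ℝ`, so that `C^∞(M, ℂ)` is a commutative ring. -/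
instance instContMDiffRingComplex : ContMDiffRing 𝓘(ℝ, ℂ) ∞ ℂ where
  contMDiff_add := by
    rw [contMDiff_iff]
    refine ⟨continuous_add, fun x y => ?_⟩
    simp only [chartAt_self_eq, mfld_simps]
    rw [contDiffOn_univ]
    exact contDiff_add
  contMDiff_mul := by
    rw [contMDiff_iff]
    refine ⟨continuous_mul, fun x y => ?_⟩
    simp only [chartAt_self_eq, mfld_simps]
    rw [contDiffOn_univ]
    exact contDiff_mul

/-- Real part of a smooth complex-valued function. -/
def reMap (F : C^∞⟮𝓡 m, M; 𝓘(ℝ, ℂ), ℂ⟯) : C^∞⟮𝓡 m, M; ℝ⟯ :=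
  ⟨fun p => (F p).re, Complex.reCLM.contMDiff.comp F.contMDiff⟩

/-- Imaginary part of a smooth complex-valued function. -/
def imMap (F : C^∞⟮𝓡 m, M; 𝓘(ℝ, ℂ), ℂ⟯) : C^∞⟮𝓡 m, M; ℝ⟯ :=
  ⟨fun p => (F p).im, Complex.imCLM.contMDiff.comp F.contMDiff⟩

/-- The smooth complex-valued function `f + i g`. -/
def mkMap (f g : C^∞⟮𝓡 m, M; ℝ⟯) : C^∞⟮𝓡 m, M; 𝓘(ℝ, ℂ), ℂ⟯ :=
  ⟨fun p => ⟨f p, g p⟩,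
    Complex.equivRealProdCLM.symm.contDiff.contMDiff.comp
      (f.contMDiff.prodMk_space g.contMDiff)⟩


@[simp] theorem reMap_apply (F : C^∞⟮𝓡 m, M; 𝓘(ℝ, ℂ), ℂ⟯) (p : M) : reMap F p = (F p).re := rfl

@[simp] theorem imMap_apply (F : C^∞⟮𝓡 m, M; 𝓘(ℝ, ℂ), ℂ⟯) (p : M) : imMap F p = (F p).im := rfl

@[simp] theorem mkMap_apply (f g : C^∞⟮𝓡 m, M; ℝ⟯) (p : M) : mkMap f g p = ⟨f p, g p⟩ := rfl

@[simp] theorem reMap_mkMap (f g : C^∞⟮𝓡 m, M; ℝ⟯) : reMap (mkMap f g) = f := by ext; rfl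

@[simp] theorem imMap_mkMap (f g : C^∞⟮𝓡 m, M; ℝ⟯) : imMap (mkMap f g) = g := by ext; rfl

theorem ext_re_im {F G : C^∞⟮𝓡 m, M; 𝓘(ℝ, ℂ), ℂ⟯} (h₁ : reMap F = reMap G)
    (h₂ : imMap F = imMap G) : F = G := by
  ext p
  exact Complex.ext (DFunLike.congr_fun h₁ p) (DFunLike.congr_fun h₂ p)

@[simp] theorem reMap_add (F G : C^∞⟮𝓡 m, M; 𝓘(ℝ, ℂ), ℂ⟯) :
    reMap (F + G) = reMap F + reMap G := by ext; rfl

@[simp] theorem imMap_add (F G : C^∞⟮𝓡 m, M; 𝓘(ℝ, ℂ), ℂ⟯) :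
    imMap (F + G) = imMap F + imMap G := by ext; rfl

@[simp] theorem reMap_neg (F : C^∞⟮𝓡 m, M; 𝓘(ℝ, ℂ), ℂ⟯) : reMap (-F) = -reMap F := by ext; rfl

@[simp] theorem imMap_neg (F : C^∞⟮𝓡 m, M; 𝓘(ℝ, ℂ), ℂ⟯) : imMap (-F) = -imMap F := by ext; rfl

@[simp] theorem reMap_zero : reMap (0 : C^∞⟮𝓡 m, M; 𝓘(ℝ, ℂ), ℂ⟯) = 0 := by ext; rfl

@[simp] theorem imMap_zero : imMap (0 : C^∞⟮𝓡 m, M; 𝓘(ℝ, ℂ), ℂ⟯) = 0 := by ext; rfl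

@[simp] theorem reMap_mul (F G : C^∞⟮𝓡 m, M; 𝓘(ℝ, ℂ), ℂ⟯) :
    reMap (F * G) = reMap F * reMap G - imMap F * imMap G := by ext; rfl

@[simp] theorem imMap_mul (F G : C^∞⟮𝓡 m, M; 𝓘(ℝ, ℂ), ℂ⟯) :
    imMap (F * G) = reMap F * imMap G + imMap F * reMap G := by ext; rfl

@[simp] theorem reMap_smul (c : ℝ) (F : C^∞⟮𝓡 m, M; 𝓘(ℝ, ℂ), ℂ⟯) :
    reMap (c • F) = c • reMap F := by
  ext p
  simp

@[simp] theorem imMap_smul (c : ℝ) (F : C^∞⟮𝓡 m, M; 𝓘(ℝ, ℂ), ℂ⟯) :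
    imMap (c • F) = c • imMap F := by
  ext p
  simp

end Functions

section Brackets

/-- A Poisson structure on the manifold `M`: a Poisson bracket on the real algebra `C^∞(M, ℝ)`. -/
abbrev PoissonStructure (m : ℕ) (M : Type*) [TopologicalSpace M]
    [ChartedSpace (EuclideanSpace ℝ (Fin m)) M] :=
  PoissonBracket ℝ C^∞⟮𝓡 m, M; ℝ⟯

/-- The complex-bilinear extension of the bracket of a Poisson manifold to the algebra
`C^∞(M, ℂ)`. -/
def PoissonBracket.complexify (π : PoissonStructure m M) :
    PoissonBracket ℝ C^∞⟮𝓡 m, M; 𝓘(ℝ, ℂ), ℂ⟯ where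
  bracket := LinearMap.mk₂ ℝ
    (fun F G => mkMap
      (π.bracket (reMap F) (reMap G) - π.bracket (imMap F) (imMap G))
      (π.bracket (reMap F) (imMap G) + π.bracket (imMap F) (reMap G)))
    (by intros; apply ext_re_im <;> simp <;> abel)
    (by intros; apply ext_re_im <;> simp [smul_sub])
    (by intros; apply ext_re_im <;> simp <;> abel)
    (by intros; apply ext_re_im <;> simp [smul_sub])
  skew F G := by
    apply ext_re_im
    · simp [π.skew (reMap F), π.skew (imMap F)]
      abel
    · simp [π.skew (reMap F), π.skew (imMap F)]
  leibniz F G K := by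
    apply ext_re_im
    · simp [π.leibniz]
      ring
    · simp [π.leibniz]
      ring
  jacobi F G K := by
    apply ext_re_im
    · simp
      linear_combination π.jacobi (reMap F) (reMap G) (reMap K)
        - π.jacobi (reMap F) (imMap G) (imMap K)
        - π.jacobi (imMap F) (reMap G) (imMap K)
        - π.jacobi (imMap F) (imMap G) (reMap K)
    · simp
      linear_combination -π.jacobi (imMap F) (imMap G) (imMap K)
        + π.jacobi (imMap F) (reMap G) (reMap K)
        + π.jacobi (reMap F) (imMap G) (reMap K)
        + π.jacobi (reMap F) (reMap G) (imMap K)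

end Brackets

section Bundle

variable {n : ℕ}

/-- `P ∈ M_n(C^∞(M, ℂ))` is a projection: a Hermitian idempotent. -/
structure IsProjectionMatrix (P : Matrix (Fin n) (Fin n) C^∞⟮𝓡 m, M; 𝓘(ℝ, ℂ), ℂ⟯) : Prop where
  idem : P * P = P
  herm : ∀ i j p, P i j p = star (P j i p)

/-- The `C^∞(M, ℂ)`-module `Γ^∞(E) = P C^∞(M, ℂ)^n` of smooth sections of the bundle `E ⊆ M × ℂ^n`,
the image of `P`. -/
abbrev Sections (P : Matrix (Fin n) (Fin n) C^∞⟮𝓡 m, M; 𝓘(ℝ, ℂ), ℂ⟯) :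
    Submodule C^∞⟮𝓡 m, M; 𝓘(ℝ, ℂ), ℂ⟯ (Fin n → C^∞⟮𝓡 m, M; 𝓘(ℝ, ℂ), ℂ⟯) :=
  LinearMap.range P.mulVecLin

/-- The bracket `{x, a}_E = P {x, a}` on `Γ^∞(E) × C^∞(M, ℂ)`, where `{x, a}` is taken
componentwise. -/
def sectionBracket (π : PoissonStructure m M)
    (P : Matrix (Fin n) (Fin n) C^∞⟮𝓡 m, M; 𝓘(ℝ, ℂ), ℂ⟯)
    (x : Sections P) (a : C^∞⟮𝓡 m, M; 𝓘(ℝ, ℂ), ℂ⟯) : Sections P :=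
  ⟨P *ᵥ fun i => π.complexify.bracket (x.1 i) a, LinearMap.mem_range_self P.mulVecLin _⟩

/-- The section `x` as a function `M → ℂ^n`. -/
def sectionFun {P : Matrix (Fin n) (Fin n) C^∞⟮𝓡 m, M; 𝓘(ℝ, ℂ), ℂ⟯} (x : Sections P) :
    M → Fin n → ℂ :=
  fun p i => x.1 i p

/-- The Levi-Civita connection `∇ = P ∘ d`: `(∇_X s)(p) = P(p) (ds)_p (X_p)`, where `d` is the
componentwise differential. -/
def leviCivita (P : Matrix (Fin n) (Fin n) C^∞⟮𝓡 m, M; 𝓘(ℝ, ℂ), ℂ⟯)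
    (X : ∀ p : M, TangentSpace (𝓡 m) p) (s : M → Fin n → ℂ) : M → Fin n → ℂ :=
  fun p => (P.map fun a => a p) *ᵥ
    fun i => (mfderiv (𝓡 m) 𝓘(ℝ, ℂ) (fun q => s q i) p (X p) : ℂ)

/-- The curvature `R^∇(X, Y) s = ∇_X ∇_Y s - ∇_Y ∇_X s - ∇_[X,Y] s` of `∇ = P ∘ d`. -/
def curvature (P : Matrix (Fin n) (Fin n) C^∞⟮𝓡 m, M; 𝓘(ℝ, ℂ), ℂ⟯)
    (X Y : ∀ p : M, TangentSpace (𝓡 m) p) (s : M → Fin n → ℂ) : M → Fin n → ℂ :=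
  leviCivita P X (leviCivita P Y s) - leviCivita P Y (leviCivita P X s)
    - leviCivita P (VectorField.mlieBracket (𝓡 m) X Y) s

end Bundle

section Leaves

variable [IsManifold (𝓡 m) ∞ M]

/-- `v ∈ T_pM` is the value at `p` of the Hamiltonian vector field of `f`:
`dh_p(v) = {h, f}(p)` for all smooth `h`. -/
def IsHamiltonianVector (π : PoissonStructure m M) (f : C^∞⟮𝓡 m, M; ℝ⟯) (p : M)
    (v : TangentSpace (𝓡 m) p) : Prop :=
  ∀ h : C^∞⟮𝓡 m, M; ℝ⟯, (mfderiv (𝓡 m) 𝓘(ℝ, ℝ) h p v : ℝ) = π.bracket h f p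

/-- `X` is the Hamiltonian vector field of `f`. -/
def IsHamiltonianField (π : PoissonStructure m M) (f : C^∞⟮𝓡 m, M; ℝ⟯)
    (X : ∀ p : M, TangentSpace (𝓡 m) p) : Prop :=
  ∀ p, IsHamiltonianVector π f p (X p)

/-- `q` is reached from `p` by flowing for time `1` along the Hamiltonian vector field of some
smooth function (not assumed complete). -/
def HamiltonianStep (π : PoissonStructure m M) (p q : M) : Prop :=
  ∃ (f : C^∞⟮𝓡 m, M; ℝ⟯) (X : ∀ p : M, TangentSpace (𝓡 m) p) (γ : ℝ → M),
    IsHamiltonianField π f X ∧ IsMIntegralCurveOn γ X (Set.Icc 0 1) ∧ γ 0 = p ∧ γ 1 = q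

/-- The symplectic leaves of `M`: the equivalence classes of points that can be joined by
piecewise Hamiltonian curves. -/
def IsSymplecticLeaf (π : PoissonStructure m M) (L : Set M) : Prop :=
  ∃ p, L = {q | Relation.EqvGen (HamiltonianStep π) p q}

/-- The tangent space at `p` of the symplectic leaf through `p`, as a subspace of `T_pM`: it
consists of the values at `p` of the Hamiltonian vector fields. -/
def leafTangentSpace (π : PoissonStructure m M) (p : M) :
    Submodule ℝ (TangentSpace (𝓡 m) p) where
  carrier := {v | ∃ f, IsHamiltonianVector π f p v}
  zero_mem' := ⟨0, fun h => by simp; rfl⟩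
  add_mem' := by
    rintro v w ⟨f, hf⟩ ⟨g, hg⟩
    refine ⟨f + g, fun h => ?_⟩
    rw [map_add, map_add]
    exact congrArg₂ (· + ·) (hf h) (hg h)
  smul_mem' := by
    rintro c v ⟨f, hf⟩
    refine ⟨c • f, fun h => ?_⟩
    rw [map_smul, map_smul]
    exact congrArg (c • ·) (hf h)

/-- `X` is a smooth vector field on `M` that is tangent to the leaf `L` at all points of `L`. -/
structure IsTangentToLeaf (π : PoissonStructure m M) (L : Set M)
    (X : ∀ p : M, TangentSpace (𝓡 m) p) : Prop where
  smooth : ContMDiff (𝓡 m) (𝓡 m).tangent ∞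
    (fun p => (⟨p, X p⟩ : TangentBundle (𝓡 m) M))
  tangent : ∀ p ∈ L, X p ∈ leafTangentSpace π p

/-- The restriction of `∇ = P ∘ d` to the leaf `L` is flat: its curvature vanishes. Vector fields
on `L` and sections of `E|_L` are represented, as they may be locally, by restrictions of vector
fields on `M` tangent to `L` and of sections of `E`; for these the restriction to `L` of `∇_X x`
is the derivative for the restricted connection. -/
def IsFlatOnLeaf {n : ℕ} (π : PoissonStructure m M)
    (P : Matrix (Fin n) (Fin n) C^∞⟮𝓡 m, M; 𝓘(ℝ, ℂ), ℂ⟯) (L : Set M) : Prop :=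
  ∀ X Y : ∀ p : M, TangentSpace (𝓡 m) p, IsTangentToLeaf π L X → IsTangentToLeaf π L Y →
    ∀ x : Sections P, ∀ p ∈ L, curvature P X Y (sectionFun x) p = 0

end Leaves

end PoissonGeometry

end

/-! All module axioms except the Lie one follow from the Leibniz rule of the bracket and from `P x =
x` on sections. In the defect of the Lie axiom, the iterated brackets of `x` cancel by Jacobi and `P
* P = P`; what is left is the first-order expression `P ({P, a} {x, b} - {P, b} {x, a})`
(`bracketCurvature_eq`). In the same way the curvature of `P ∘ d` reduces to `P (dP(X) dx(Y) - dP(Y)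
dx(X))`, which at `p` sees only `X p` and `Y p` (`curvature_eq_pointCurvature`). Since `{·, f}` is
differentiation along the Hamiltonian field of `f`, the two expressions agree at Hamiltonian vectors
of real functions (`bracketCurvature_apply`); complex functions are reached by linearity.

The tangent vectors of a leaf are exactly the values of Hamiltonian fields, and every point lies on
a leaf, so both conditions say that the same expression vanishes. Flatness is tested on smooth
vector fields, so the converse also needs Hamiltonian fields to exist and be smooth: `{·, f}` at `p`
is a derivation, hence a tangent vector by Hadamard's lemma (`exists_tangentVector_of_derivation`),
and the chart components of the field are themselves brackets. -/

namespace PoissonGeometry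

/-! ### Algebraic curvature of a projected Poisson bracket -/

section Algebra

variable {k A ι : Type*} [CommRing k] [CommRing A] [Algebra k A] [Fintype ι]

theorem PoissonBracket.leibniz_right (pb : PoissonBracket k A) (a b c : A) :
    pb.bracket a (b * c) = c * pb.bracket a b + b * pb.bracket a c := by
  rw [pb.skew, pb.leibniz, pb.skew b, pb.skew c]
  ring

theorem PoissonBracket.bracket_bracket (pb : PoissonBracket k A) (a b c : A) :
    pb.bracket a (pb.bracket b c) =
      pb.bracket (pb.bracket a b) c - pb.bracket (pb.bracket a c) b := by
  have h := pb.jacobi a b c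
  rw [pb.skew (pb.bracket a b), pb.skew (pb.bracket a c), pb.skew a c, map_neg]
  rw [pb.skew b, pb.skew c] at h ⊢
  simp only [pb.skew c a, map_neg] at h ⊢
  linear_combination h

/-- The bracket of a vector with a scalar, taken componentwise. -/
def vecBracket (pb : PoissonBracket k A) (x : ι → A) (a : A) : ι → A :=
  fun i => pb.bracket (x i) a

theorem vecBracket_mulVec (pb : PoissonBracket k A) (Q : Matrix ι ι A) (x : ι → A) (a : A) :
    vecBracket pb (Q *ᵥ x) a =
      (Q.map fun q => pb.bracket q a) *ᵥ x + Q *ᵥ vecBracket pb x a := by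
  ext i
  simp only [vecBracket, Matrix.mulVec, dotProduct, map_sum, LinearMap.sum_apply, pb.leibniz,
    Pi.add_apply, Matrix.map_apply, Finset.sum_add_distrib]
  exact add_comm _ _

omit [Fintype ι] in
theorem vecBracket_bracket (pb : PoissonBracket k A) (x : ι → A) (a b : A) :
    vecBracket pb x (pb.bracket a b) =
      vecBracket pb (vecBracket pb x a) b - vecBracket pb (vecBracket pb x b) a := by
  ext i
  exact pb.bracket_bracket _ _ _

/-- The algebraic curvature `P ({P, a} {x, b} - {P, b} {x, a})` of the bracket `P {x, a}`. -/
def bracketCurvature (pb : PoissonBracket k A) (Q : Matrix ι ι A) (a b : A) (x : ι → A) : ι → A :=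
  Q *ᵥ ((Q.map fun q => pb.bracket q a) *ᵥ vecBracket pb x b
    - (Q.map fun q => pb.bracket q b) *ᵥ vecBracket pb x a)

/-- Expanding the outer brackets by Leibniz, each inner `Q` gives a `{Q, ·}` term and a second-order
term; the latter cancel by Jacobi once `Q * Q = Q` absorbs the inner `Q`. -/
theorem bracketCurvature_eq (pb : PoissonBracket k A) {Q : Matrix ι ι A} (hQ : Q * Q = Q)
    (a b : A) (x : ι → A) :
    bracketCurvature pb Q a b x = Q *ᵥ vecBracket pb x (pb.bracket a b)
      - (Q *ᵥ vecBracket pb (Q *ᵥ vecBracket pb x a) b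
        - Q *ᵥ vecBracket pb (Q *ᵥ vecBracket pb x b) a) := by
  simp only [bracketCurvature, vecBracket_mulVec, vecBracket_bracket, Matrix.mulVec_add,
    Matrix.mulVec_sub, Matrix.mulVec_mulVec, hQ]
  abel

theorem bracketCurvature_swap (pb : PoissonBracket k A) (Q : Matrix ι ι A) (a b : A)
    (x : ι → A) : bracketCurvature pb Q a b x = -bracketCurvature pb Q b a x := by
  simp [bracketCurvature, Matrix.mulVec_sub]

/-- The algebraic curvature sees `a` only through the derivation `{·, a}` and is `A`-linear in it.
This is what reduces complex arguments to real ones. -/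
theorem bracketCurvature_eq_add_smul (pb : PoissonBracket k A) (Q : Matrix ι ι A)
    {a a₁ a₂ c : A} (h : ∀ y, pb.bracket y a = pb.bracket y a₁ + c * pb.bracket y a₂) (b : A)
    (x : ι → A) :
    bracketCurvature pb Q a b x =
      bracketCurvature pb Q a₁ b x + c • bracketCurvature pb Q a₂ b x := by
  have h₁ : (Q.map fun q => pb.bracket q a) =
      (Q.map fun q => pb.bracket q a₁) + c • Q.map fun q => pb.bracket q a₂ := by
    ext i j
    simp [h]
  have h₂ : vecBracket pb x a = vecBracket pb x a₁ + c • vecBracket pb x a₂ := by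
    ext i
    simp [h, vecBracket]
  simp only [bracketCurvature, h₁, h₂, Matrix.mulVec_add, Matrix.add_mulVec, Matrix.mulVec_sub,
    Matrix.smul_mulVec, Matrix.mulVec_smul, smul_sub]
  abel

end Algebra

/-! ### Poisson module axioms and reduction to real functions -/

section Module

variable {m n : ℕ} {M : Type*} [TopologicalSpace M] [ChartedSpace (EuclideanSpace ℝ (Fin m)) M]
  {P : Matrix (Fin n) (Fin n) C^∞⟮𝓡 m, M; 𝓘(ℝ, ℂ), ℂ⟯}

theorem IsProjectionMatrix.mulVec_section (hP : IsProjectionMatrix P) (x : Sections P) :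
    P *ᵥ x.1 = x.1 := by
  obtain ⟨_, y, rfl⟩ := x
  simp [Matrix.mulVec_mulVec, hP.idem]

theorem sectionBracket_coe (π : PoissonStructure m M) (x : Sections P)
    (a : C^∞⟮𝓡 m, M; 𝓘(ℝ, ℂ), ℂ⟯) :
    (sectionBracket π P x a : Fin n → C^∞⟮𝓡 m, M; 𝓘(ℝ, ℂ), ℂ⟯) =
      P *ᵥ vecBracket π.complexify x.1 a := rfl

/-- Linearity and both Leibniz rules pass through `P`, the left one because `P` fixes sections; only
the Lie axiom is a genuine condition. -/
theorem isPoissonModule_iff (π : PoissonStructure m M) (hP : IsProjectionMatrix P) :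
    IsPoissonModule π.complexify (sectionBracket π P) ↔
      ∀ a b, ∀ x : Sections P, bracketCurvature π.complexify P a b x.1 = 0 := by
  have key : ∀ a b, ∀ x : Sections P, bracketCurvature π.complexify P a b x.1 = 0 ↔
      sectionBracket π P x (π.complexify.bracket a b) =
        sectionBracket π P (sectionBracket π P x a) b
          - sectionBracket π P (sectionBracket π P x b) a := by
    intro a b x
    rw [bracketCurvature_eq _ hP.idem, sub_eq_zero, Subtype.ext_iff]
    rfl
  refine ⟨fun h a b x => (key a b x).2 (h.lie x a b), fun h => ?_⟩
  have smul_mul : ∀ (c : ℝ) (f g : C^∞⟮𝓡 m, M; 𝓘(ℝ, ℂ), ℂ⟯), c • (f * g) = f * c • g := by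
    intro c f g
    ext p
    exact (mul_smul_comm c (f p) (g p)).symm
  refine ⟨fun x y a => ?_, fun c x a => ?_, fun x a b => ?_, fun c x a => ?_, fun x a b => ?_,
    fun x a b => ?_, fun x a b => (key a b x).1 (h a b x)⟩
  · ext1
    simp only [sectionBracket_coe, Submodule.coe_add, ← Matrix.mulVec_add]
    congr 1; ext1 i
    simp [vecBracket]
  · ext1
    rw [sectionBracket_coe]
    have : vecBracket π.complexify (c • x).1 a = c • vecBracket π.complexify x.1 a := by
      ext1 i
      simp [vecBracket]
    rw [this, Matrix.mulVec_smul]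
    rfl
  · ext1
    simp only [sectionBracket_coe, Submodule.coe_add, ← Matrix.mulVec_add]
    congr 1; ext1 i
    simp [vecBracket]
  · ext1
    rw [sectionBracket_coe]
    have : vecBracket π.complexify x.1 (c • a) = c • vecBracket π.complexify x.1 a := by
      ext1 i
      simp [vecBracket]
    rw [this, Matrix.mulVec_smul]
    rfl
  · ext1
    have : vecBracket π.complexify (a • x).1 b =
        a • vecBracket π.complexify x.1 b + π.complexify.bracket a b • x.1 := by
      ext1 i
      simp [vecBracket, π.complexify.leibniz]
    rw [sectionBracket_coe, this, Matrix.mulVec_add, Matrix.mulVec_smul, Matrix.mulVec_smul,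
      hP.mulVec_section]
    rfl
  · ext1
    have : vecBracket π.complexify x.1 (a * b) =
        b • vecBracket π.complexify x.1 a + a • vecBracket π.complexify x.1 b := by
      ext1 i
      simp [vecBracket, π.complexify.leibniz_right]
    rw [sectionBracket_coe, this, Matrix.mulVec_add, Matrix.mulVec_smul, Matrix.mulVec_smul]
    rfl

theorem bracket_complexify_eq (π : PoissonStructure m M) (F a : C^∞⟮𝓡 m, M; 𝓘(ℝ, ℂ), ℂ⟯) :
    π.complexify.bracket F a = π.complexify.bracket F (mkMap (reMap a) 0)
      + mkMap 0 1 * π.complexify.bracket F (mkMap (imMap a) 0) := by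
  apply ext_re_im <;> simp [PoissonBracket.complexify] <;> ring

/-- The algebraic curvature vanishes as soon as it vanishes on real functions. -/
theorem bracketCurvature_eq_zero_of_real (π : PoissonStructure m M)
    (x : Fin n → C^∞⟮𝓡 m, M; 𝓘(ℝ, ℂ), ℂ⟯)
    (h : ∀ f g, bracketCurvature π.complexify P (mkMap f 0) (mkMap g 0) x = 0)
    (a b : C^∞⟮𝓡 m, M; 𝓘(ℝ, ℂ), ℂ⟯) : bracketCurvature π.complexify P a b x = 0 := by
  have h' : ∀ f b, bracketCurvature π.complexify P (mkMap f 0) b x = 0 := by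
    intro f b
    -- Linearity is available in the first slot only, so antisymmetry moves `b` there and back.
    rw [bracketCurvature_swap, bracketCurvature_eq_add_smul _ _
      (fun y => bracket_complexify_eq π y b), bracketCurvature_swap, h,
      bracketCurvature_swap _ _ (mkMap (imMap b) 0), h]
    simp
  rw [bracketCurvature_eq_add_smul _ _ (fun y => bracket_complexify_eq π y a), h', h']
  simp

end Module

end PoissonGeometry

namespace PoissonGeometry

/-! ### Lie bracket of vector fields as a commutator of derivatives -/

section LieBracket

open VectorField Set Filter Topology

variable {m : ℕ} {M : Type*} [TopologicalSpace M] [ChartedSpace (EuclideanSpace ℝ (Fin m)) M]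
  {F : Type*} [NormedAddCommGroup F] [NormedSpace ℝ F]

/-- The derivative of a vector-valued function in the direction of a tangent vector. -/
noncomputable def dirDeriv (f : M → F) (p : M) (v : TangentSpace (𝓡 m) p) : F :=
  mfderiv (𝓡 m) 𝓘(ℝ, F) f p v

variable [IsManifold (𝓡 m) ∞ M]

/-- The directional derivative of a function, computed in a chart. -/
theorem dirDeriv_eq_fderiv_chart {f : M → F} (p : M) {y : EuclideanSpace ℝ (Fin m)}
    (hy : y ∈ (extChartAt (𝓡 m) p).target)
    (hf : MDifferentiableAt (𝓡 m) 𝓘(ℝ, F) f ((extChartAt (𝓡 m) p).symm y))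
    (X : ∀ q : M, TangentSpace (𝓡 m) q) :
    dirDeriv f ((extChartAt (𝓡 m) p).symm y) (X ((extChartAt (𝓡 m) p).symm y)) =
      fderiv ℝ (f ∘ (extChartAt (𝓡 m) p).symm) y
        (mpullbackWithin 𝓘(ℝ, EuclideanSpace ℝ (Fin m)) (𝓡 m) (extChartAt (𝓡 m) p).symm X
          (range (𝓡 m)) y) := by
  have hinv := isInvertible_mfderivWithin_extChartAt_symm (I := 𝓡 m) hy
  have hd : MDifferentiableWithinAt 𝓘(ℝ, EuclideanSpace ℝ (Fin m)) (𝓡 m)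
      (extChartAt (𝓡 m) p).symm (range (𝓡 m)) y :=
    mdifferentiableWithinAt_extChartAt_symm (I := 𝓡 m) hy
  have hu : UniqueMDiffWithinAt 𝓘(ℝ, EuclideanSpace ℝ (Fin m)) (range (𝓡 m)) y := by
    rw [modelWithCornersSelf_coe, range_id]
    exact uniqueMDiffWithinAt_univ _
  have h₁ : fderiv ℝ (f ∘ (extChartAt (𝓡 m) p).symm) y =
      mfderivWithin 𝓘(ℝ, EuclideanSpace ℝ (Fin m)) 𝓘(ℝ, F) (f ∘ (extChartAt (𝓡 m) p).symm)
        (range (𝓡 m)) y := by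
    rw [modelWithCornersSelf_coe, range_id, mfderivWithin_univ, mfderiv_eq_fderiv]
  have h₂ := mfderiv_comp_mfderivWithin y hf hd hu
  have h₃ := DFunLike.congr_fun (h₁.trans h₂)
    (mpullbackWithin 𝓘(ℝ, EuclideanSpace ℝ (Fin m)) (𝓡 m) (extChartAt (𝓡 m) p).symm X
          (range (𝓡 m)) y)
  refine Eq.trans ?_ h₃.symm
  -- The pullback of `X` is the inverse of the derivative of the inverse chart applied to `X`, so
  -- applying that derivative recovers `X`.
  have h₄ := DFunLike.congr_fun hinv.self_comp_inverse (X ((extChartAt (𝓡 m) p).symm y))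
  exact (congrArg (mfderiv (𝓡 m) 𝓘(ℝ, F) f ((extChartAt (𝓡 m) p).symm y)) h₄).symm

theorem dirDeriv_eq_fderiv_mfderiv_extChartAt {f : M → F} (p : M)
    (hf : ContDiffAt ℝ ∞ (f ∘ (extChartAt (𝓡 m) p).symm) (extChartAt (𝓡 m) p p))
    (v : TangentSpace (𝓡 m) p) :
    dirDeriv f p v = fderiv ℝ (f ∘ (extChartAt (𝓡 m) p).symm) (extChartAt (𝓡 m) p p)
        (dirDeriv (extChartAt (𝓡 m) p) p v) := by
  have h₁ : f =ᶠ[𝓝 p] (f ∘ (extChartAt (𝓡 m) p).symm) ∘ extChartAt (𝓡 m) p := by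
    filter_upwards [extChartAt_source_mem_nhds (I := 𝓡 m) p] with q hq
    simp only [Function.comp, (extChartAt (𝓡 m) p).left_inv hq]
  have hd : MDifferentiableAt (𝓡 m) 𝓘(ℝ, EuclideanSpace ℝ (Fin m)) (extChartAt (𝓡 m) p) p :=
    mdifferentiableAt_extChartAt (mem_chart_source _ p)
  have h₂ := mfderiv_comp p (hf.differentiableAt (by simp)).mdifferentiableAt hd
  have h₃ := DFunLike.congr_fun (h₁.mfderiv_eq.trans h₂) v
  refine Eq.trans h₃ ?_
  rw [mfderiv_eq_fderiv]
  rfl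

/-- The directional derivative along the Lie bracket of two vector fields is the commutator of the
directional derivatives. -/
theorem dirDeriv_mlieBracket {f : M → F} (hf : ContMDiff (𝓡 m) 𝓘(ℝ, F) ∞ f)
    {X Y : ∀ q : M, TangentSpace (𝓡 m) q}
    (hX : ContMDiff (𝓡 m) (𝓡 m).tangent ∞ (fun p => (⟨p, X p⟩ : TangentBundle (𝓡 m) M)))
    (hY : ContMDiff (𝓡 m) (𝓡 m).tangent ∞ (fun p => (⟨p, Y p⟩ : TangentBundle (𝓡 m) M)))
    (hXf : MDifferentiable (𝓡 m) 𝓘(ℝ, F) fun q => dirDeriv f q (X q))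
    (hYf : MDifferentiable (𝓡 m) 𝓘(ℝ, F) fun q => dirDeriv f q (Y q))
    (p : M) :
    dirDeriv f p (mlieBracket (𝓡 m) X Y p) =
      dirDeriv (fun q => dirDeriv f q (Y q)) p (X p)
      - dirDeriv (fun q => dirDeriv f q (X q)) p (Y p) := by
  set φ := extChartAt (𝓡 m) p with hφ
  have hp : φ p ∈ φ.target := mem_extChartAt_target p
  have hpp : φ.symm (φ p) = p := extChartAt_to_inv p
  have hmd : MDifferentiable (𝓡 m) 𝓘(ℝ, F) f := hf.mdifferentiable (by simp)
  have key : ∀ (Z : ∀ q : M, TangentSpace (𝓡 m) q) (u : M → F),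
      MDifferentiable (𝓡 m) 𝓘(ℝ, F) u → dirDeriv u p (Z p) =
      fderiv ℝ (u ∘ φ.symm) (φ p) (mpullbackWithin 𝓘(ℝ, EuclideanSpace ℝ (Fin m)) (𝓡 m)
        φ.symm Z (range (𝓡 m)) (φ p)) := by
    intro Z u hu
    have := dirDeriv_eq_fderiv_chart p hp (hu _) Z
    rwa [← hφ, hpp] at this
  -- This must hold on a neighbourhood, since both sides get differentiated again.
  have ev : ∀ (Z : ∀ q : M, TangentSpace (𝓡 m) q),
      (fun q => dirDeriv f q (Z q)) ∘ φ.symm =ᶠ[𝓝 (φ p)]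
      fun y => fderiv ℝ (f ∘ φ.symm) y (mpullbackWithin 𝓘(ℝ, EuclideanSpace ℝ (Fin m)) (𝓡 m)
        φ.symm Z (range (𝓡 m)) y) := by
    intro Z
    filter_upwards [extChartAt_target_mem_nhds (I := 𝓡 m) p] with y hy
    exact dirDeriv_eq_fderiv_chart p hy (hmd _) Z
  have : IsManifold (𝓡 m) 2 M := IsManifold.of_le (n := ∞) ENat.LEInfty.out
  have univ_eq : φ.symm ⁻¹' univ ∩ range (𝓡 m) = univ := by simp
  have diff : ∀ (Z : ∀ q : M, TangentSpace (𝓡 m) q),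
      ContMDiff (𝓡 m) (𝓡 m).tangent ∞ (fun p => (⟨p, Z p⟩ : TangentBundle (𝓡 m) M)) →
      DifferentiableAt ℝ (mpullbackWithin 𝓘(ℝ, EuclideanSpace ℝ (Fin m)) (𝓡 m)
        φ.symm Z (range (𝓡 m))) (φ p) := by
    intro Z hZ
    have := MDifferentiableWithinAt.differentiableWithinAt_mpullbackWithin_vectorField
      (s := univ) ((hZ.mdifferentiable (by simp)) p).mdifferentiableWithinAt
    rw [← hφ, univ_eq] at this
    exact differentiableWithinAt_univ.1 this
  have hcd : ContDiffAt ℝ ∞ (f ∘ φ.symm) (φ p) := by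
    have h := (contMDiffOn_extChartAt_symm (n := ∞) (I := 𝓡 m) p).contMDiffAt
      (extChartAt_target_mem_nhds (I := 𝓡 m) p)
    exact (hf.contMDiffAt.comp (φ p) h).contDiffAt
  obtain ⟨V, hV⟩ : ∃ V : EuclideanSpace ℝ (Fin m) → EuclideanSpace ℝ (Fin m), V =
    mpullbackWithin 𝓘(ℝ, EuclideanSpace ℝ (Fin m)) (𝓡 m) φ.symm X (range (𝓡 m)) := ⟨_, rfl⟩
  obtain ⟨W, hW⟩ : ∃ W : EuclideanSpace ℝ (Fin m) → EuclideanSpace ℝ (Fin m), W =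
    mpullbackWithin 𝓘(ℝ, EuclideanSpace ℝ (Fin m)) (𝓡 m) φ.symm Y (range (𝓡 m)) := ⟨_, rfl⟩
  have hinv := isInvertible_mfderiv_extChartAt (I := 𝓡 m) (mem_extChartAt_source (I := 𝓡 m) p)
  -- The manifold bracket is the chart bracket pulled back by the derivative of `φ`; pushing it
  -- forward leaves the chart bracket.
  have hb : dirDeriv φ p (mlieBracket (𝓡 m) X Y p) = lieBracket ℝ V W (φ p) := by
    rw [← lieBracketWithin_univ, ← univ_eq, hV, hW]
    exact DFunLike.congr_fun hinv.self_comp_inverse _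
  have h₁ := fderiv_apply_lieBracket hcd (n := ∞)
    (by rw [minSmoothness_of_isRCLikeNormedField]; exact ENat.LEInfty.out)
    (hW ▸ diff Y hY) (hV ▸ diff X hX)
  rw [key X _ hYf, key Y _ hXf, (ev X).fderiv_eq, (ev Y).fderiv_eq,
    dirDeriv_eq_fderiv_mfderiv_extChartAt p hcd, hb, h₁, hV, hW]

end LieBracket

end PoissonGeometry

namespace PoissonGeometry

/-! ### Parameter integrals and Hadamard's lemma -/

section Hadamard

variable {E W : Type*} [NormedAddCommGroup E] [NormedSpace ℝ E]
  [NormedAddCommGroup W] [NormedSpace ℝ W]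

open MeasureTheory Set in
/-- An integral over `[0, 1]` depending smoothly on a parameter is smooth. -/
theorem contDiff_intervalIntegral {F : E → ℝ → W} (hF : ContDiff ℝ ∞ (Function.uncurry F)) :
    ContDiff ℝ ∞ fun x => ∫ t in (0 : ℝ)..1, F x t := by
  obtain ⟨χ, hχ₁, hχ₂, hχ₃⟩ : ∃ χ : ℝ → ℝ, ContDiff ℝ ∞ χ ∧ (∀ t ∉ Metric.closedBall 0 2, χ t = 0) ∧
      ∀ t ∈ Metric.closedBall (0 : ℝ) 1, χ t = 1 := by
    let b : ContDiffBump (0 : ℝ) := ⟨1, 2, one_pos, one_lt_two⟩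
    refine ⟨b, b.contDiff, fun t ht => b.zero_of_le_dist ?_, fun t ht => b.one_of_mem_closedBall ht⟩
    exact (not_le.1 ht).le
  have hloc : LocallyIntegrable (indicator (Ioc (0 : ℝ) 1) fun _ => (1 : ℝ)) volume :=
    ((integrable_indicator_iff measurableSet_Ioc).2 (by simp)).locallyIntegrable
  -- The integral is the convolution at `0` of the indicator of `(0, 1]` with `t ↦ χ t • F x (-t)`.
  -- The cutoff supplies the compact support and equals `1` where the indicator lives.
  have h := contDiffOn_convolution_right_with_param_comp (𝕜 := ℝ) (μ := volume) (n := ⊤)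
    (ContinuousLinearMap.lsmul ℝ ℝ) (s := univ) (v := fun _ : E => (0 : ℝ)) contDiffOn_const
    (g := fun x t => χ t • F x (-t)) isOpen_univ (isCompact_closedBall (0 : ℝ) 2)
    (fun p t _ ht => by simp [hχ₂ t ht]) hloc
    (ContDiff.contDiffOn
      ((hχ₁.comp contDiff_snd).smul (hF.comp (contDiff_fst.prodMk contDiff_snd.neg))))
  rw [contDiffOn_univ] at h
  convert h using 2 with x
  rw [convolution_def, intervalIntegral.integral_of_le zero_le_one,
    ← integral_indicator measurableSet_Ioc]
  congr 1 with t
  by_cases ht : t ∈ Ioc (0 : ℝ) 1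
  · have : χ (-t) = 1 := hχ₃ _ (by simp [abs_of_pos ht.1, ht.2])
    simp [ht, this]
  · simp [ht]

/-- **Hadamard's lemma**. -/
theorem exists_contDiff_hadamard [CompleteSpace W] {g : E → W} (hg : ContDiff ℝ ∞ g) (y : E) :
    ∃ G : E → E →L[ℝ] W, ContDiff ℝ ∞ G ∧ G y = fderiv ℝ g y ∧
      ∀ x, g x = g y + G x (x - y) := by
  have hdg : ContDiff ℝ ∞ (fderiv ℝ g) := hg.fderiv_right (by simp)
  have hF : ContDiff ℝ ∞ (Function.uncurry fun (x : E) (t : ℝ) =>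
      fderiv ℝ g (y + t • (x - y))) := by
    apply hdg.comp
    fun_prop
  -- Integrate the derivative of `g` along the segment from `y` to `x`.
  refine ⟨fun x => ∫ t in (0 : ℝ)..1, fderiv ℝ g (y + t • (x - y)),
    contDiff_intervalIntegral hF, by simp, fun x => ?_⟩
  have hcont : Continuous fun t : ℝ => fderiv ℝ g (y + t • (x - y)) :=
    hdg.continuous.comp (by fun_prop)
  beta_reduce
  rw [ContinuousLinearMap.intervalIntegral_apply (hcont.intervalIntegrable _ _)]
  have hderiv : ∀ t : ℝ, HasDerivAt (fun t : ℝ => g (y + t • (x - y)))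
      (fderiv ℝ g (y + t • (x - y)) (x - y)) t := by
    intro t
    have h₁ : HasDerivAt (fun t : ℝ => y + t • (x - y)) (x - y) t := by
      simpa using ((hasDerivAt_id t).smul_const (x - y)).const_add y
    exact ((hg.differentiable (by simp)) _).hasFDerivAt.comp_hasDerivAt t h₁
  rw [intervalIntegral.integral_eq_sub_of_hasDerivAt (fun t _ => hderiv t)
    ((hcont.clm_apply continuous_const).intervalIntegrable _ _)]
  simp

end Hadamard

end PoissonGeometry

namespace PoissonGeometry

/-! ### Derivations at a point are tangent vectors -/

section Derivation

open Set Filter Topology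

variable {m : ℕ} {M : Type*} [TopologicalSpace M] [ChartedSpace (EuclideanSpace ℝ (Fin m)) M]
  [IsManifold (𝓡 m) ∞ M] [T2Space M]

/-- A derivation at a point only depends on the germ of the function. -/
theorem derivation_eq_of_eventuallyEq {p : M} {D : C^∞⟮𝓡 m, M; ℝ⟯ →ₗ[ℝ] ℝ}
    (hD : ∀ f g, D (f * g) = f p * D g + D f * g p) {f g : C^∞⟮𝓡 m, M; ℝ⟯}
    (h : f =ᶠ[𝓝 p] g) : D f = D g := by
  -- With a bump `χ` supported where `f = g`, the product `(f - g) χ` is zero; applying `D` leaves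
  -- `D (f - g) = 0`, as `χ p = 1` and `(f - g) p = 0`.
  obtain ⟨χ, -, hχ⟩ := (SmoothBumpFunction.nhds_basis_support (I := 𝓡 m) h).mem_iff.1 h
  let c : C^∞⟮𝓡 m, M; ℝ⟯ := ⟨χ, χ.contMDiff⟩
  have h₀ : (f - g) * c = 0 := by
    ext q
    by_cases hq : q ∈ Function.support χ
    · have : f q = g q := hχ hq
      simp [this]
    · have : c q = 0 := Function.notMem_support.1 hq
      simp [this]
  have h₁ := hD (f - g) c
  have h₂ : c p = 1 := χ.eq_one
  have h₃ : (f - g) p = 0 := sub_eq_zero.2 h.self_of_nhds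
  rw [h₀, map_zero, h₂, h₃, map_sub] at h₁
  linarith

omit [T2Space M] in
/-- Every smooth function near a point extends to a smooth function on the model space. -/
theorem exists_contDiff_extension {F : Type*} [NormedAddCommGroup F] [NormedSpace ℝ F] {f : M → F}
    (hf : ContMDiff (𝓡 m) 𝓘(ℝ, F) ∞ f) (p : M) :
    ∃ g : EuclideanSpace ℝ (Fin m) → F, ContDiff ℝ ∞ g ∧
      g =ᶠ[𝓝 (extChartAt (𝓡 m) p p)] f ∘ (extChartAt (𝓡 m) p).symm := by
  obtain ⟨χ⟩ : Nonempty (SmoothBumpFunction (𝓡 m) p) := inferInstance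
  let b := χ.toContDiffBump
  refine ⟨fun y => b y • (f ∘ (extChartAt (𝓡 m) p).symm) y, ?_, ?_⟩
  · rw [contDiff_iff_contDiffAt]
    intro y
    -- The closed support lies in the chart target, where both factors are smooth; off it the
    -- product is locally zero.
    by_cases hy : y ∈ tsupport b
    · have hyt : y ∈ (extChartAt (𝓡 m) p).target := by
        rw [b.tsupport_eq] at hy
        exact χ.closedBall_subset ⟨hy, by simp⟩
      have h := (contMDiffOn_extChartAt_symm (n := ∞) (I := 𝓡 m) p).contMDiffAt
        ((isOpen_extChartAt_target p).mem_nhds hyt)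
      exact b.contDiff.contDiffAt.smul (hf.contMDiffAt.comp y h).contDiffAt
    · refine (contDiffAt_const (c := (0 : F))).congr_of_eventuallyEq ?_
      filter_upwards [notMem_tsupport_iff_eventuallyEq.1 hy] with z hz
      exact (congrArg (· • _) (show b z = 0 from hz)).trans (zero_smul ℝ _)
  · filter_upwards [b.eventuallyEq_one] with y hy
    exact (congrArg (· • _) (show b y = 1 from hy)).trans (one_smul ℝ _)

/-- Every smooth function near a point of the model space pulls back to a global smooth function. -/
theorem exists_contMDiffMap_chart {f : EuclideanSpace ℝ (Fin m) → ℝ} (hf : ContDiff ℝ ∞ f)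
    (p : M) : ∃ g : C^∞⟮𝓡 m, M; ℝ⟯, g =ᶠ[𝓝 p] f ∘ extChartAt (𝓡 m) p := by
  obtain ⟨χ⟩ : Nonempty (SmoothBumpFunction (𝓡 m) p) := inferInstance
  refine ⟨⟨_, χ.contMDiff_smul (g := f ∘ extChartAt (𝓡 m) p) ?_⟩, ?_⟩
  · exact hf.contMDiff.comp_contMDiffOn (contMDiffOn_extChartAt (n := ∞))
  · filter_upwards [χ.eventuallyEq_one] with q hq
    simp [hq]

/-- Every derivation at a point of the algebra of smooth functions is given by a tangent vector. -/
theorem exists_tangentVector_of_derivation {p : M} {D : C^∞⟮𝓡 m, M; ℝ⟯ →ₗ[ℝ] ℝ}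
    (hD : ∀ f g, D (f * g) = f p * D g + D f * g p) :
    ∃ v : TangentSpace (𝓡 m) p, ∀ h : C^∞⟮𝓡 m, M; ℝ⟯, dirDeriv h p v = D h := by
  set φ := extChartAt (𝓡 m) p with hφ
  -- Globally defined functions that agree near `p` with the chart coordinates centred at `p`; the
  -- values of `D` on them are the components of the tangent vector.
  have hw : ∀ i, ∃ w : C^∞⟮𝓡 m, M; ℝ⟯, w =ᶠ[𝓝 p] (fun y => y i - φ p i) ∘ φ := fun i =>
    exists_contMDiffMap_chart (by fun_prop) p
  choose w hw using hw
  let d : EuclideanSpace ℝ (Fin m) := WithLp.toLp 2 fun i => D (w i)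
  have hinv := isInvertible_mfderiv_extChartAt (I := 𝓡 m) (mem_extChartAt_source (I := 𝓡 m) p)
  refine ⟨(mfderiv (𝓡 m) 𝓘(ℝ, EuclideanSpace ℝ (Fin m)) φ p).inverse d, fun h => ?_⟩
  have hφd : dirDeriv φ p ((mfderiv (𝓡 m) 𝓘(ℝ, EuclideanSpace ℝ (Fin m)) φ p).inverse d) = d :=
    DFunLike.congr_fun hinv.self_comp_inverse d
  obtain ⟨g, hg, hgh⟩ := exists_contDiff_extension h.contMDiff p
  rw [dirDeriv_eq_fderiv_mfderiv_extChartAt p (hg.contDiffAt.congr_of_eventuallyEq hgh.symm), hφd,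
    ← hgh.fderiv_eq]
  obtain ⟨G, hG, hGp, hGg⟩ := exists_contDiff_hadamard hg (φ p)
  have hk : ∀ i, ∃ k : C^∞⟮𝓡 m, M; ℝ⟯,
      k =ᶠ[𝓝 p] (fun y => G y (EuclideanSpace.single i 1)) ∘ φ := fun i =>
    exists_contMDiffMap_chart (hG.clm_apply contDiff_const) p
  choose k hk using hk
  have hexp : ∀ (A : EuclideanSpace ℝ (Fin m) →L[ℝ] ℝ) (v : EuclideanSpace ℝ (Fin m)),
      A v = ∑ i, v i * A (EuclideanSpace.single i 1) := by
    intro A v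
    conv_lhs => rw [← (EuclideanSpace.basisFun (Fin m) ℝ).sum_repr v]
    simp
  have h1 : D 1 = 0 := by
    have := hD 1 1
    simp at this
    exact this
  -- Hadamard's expansion near `p`. As `D` kills constants and `w i p = 0`, it yields `D h = ∑ i, D
  -- (w i) * k i p`, where `k i p` is a partial derivative of `h`.
  have hloc : h =ᶠ[𝓝 p] (h p • (1 : C^∞⟮𝓡 m, M; ℝ⟯) + ∑ i, w i * k i : C^∞⟮𝓡 m, M; ℝ⟯) := by
    have hgh' : ∀ᶠ q in 𝓝 p, g (φ q) = h (φ.symm (φ q)) :=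
      (continuousAt_extChartAt p).eventually hgh
    have hsum : ∀ q, (h p • (1 : C^∞⟮𝓡 m, M; ℝ⟯) + ∑ i, w i * k i : C^∞⟮𝓡 m, M; ℝ⟯) q =
        h p + ∑ i, w i q * k i q := by
      intro q
      have := congrFun (map_sum (ContMDiffMap.coeFnAddMonoidHom (I := 𝓡 m) (I' := 𝓘(ℝ, ℝ)) (N := M)
        (G := ℝ) (n := ∞)) (fun i => w i * k i) Finset.univ) q
      rw [Finset.sum_apply] at this
      refine congrArg₂ (· + ·) ?_ this
      exact mul_one _
    filter_upwards [hgh', eventually_all.2 hw, eventually_all.2 hk,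
      extChartAt_source_mem_nhds (I := 𝓡 m) p] with q hq hwq hkq hqs
    have e₁ : φ.symm (φ q) = q := φ.left_inv hqs
    have e₂ : g (φ p) = h p := by
      rw [hgh.self_of_nhds]
      simp
    rw [hsum, ← e₂, ← congrArg h e₁, ← hq, hGg (φ q), hexp]
    simp [hwq, hkq]
  rw [derivation_eq_of_eventuallyEq hD hloc, map_add, map_smul, h1, smul_zero, zero_add, map_sum,
    hexp]
  refine Finset.sum_congr rfl fun i _ => ?_
  have e₁ : w i p = 0 := by simp [(hw i).self_of_nhds]
  have e₂ : k i p = fderiv ℝ g (φ p) (EuclideanSpace.single i 1) := by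
    simp [(hk i).self_of_nhds, hGp]
  rw [hD, e₁, e₂, zero_mul, zero_add]

end Derivation

/-! ### Existence and smoothness of Hamiltonian vector fields -/

section HamiltonianFields

open Set Filter Topology

variable {m : ℕ} {M : Type*} [TopologicalSpace M] [ChartedSpace (EuclideanSpace ℝ (Fin m)) M]
  [IsManifold (𝓡 m) ∞ M] [T2Space M]

theorem exists_isHamiltonianField (π : PoissonStructure m M) (f : C^∞⟮𝓡 m, M; ℝ⟯) :
    ∃ X : ∀ p : M, TangentSpace (𝓡 m) p, IsHamiltonianField π f X := by
  have h : ∀ p : M, ∃ v : TangentSpace (𝓡 m) p, IsHamiltonianVector π f p v := by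
    intro p
    let ev : C^∞⟮𝓡 m, M; ℝ⟯ →ₗ[ℝ] ℝ :=
      { toFun := fun h => h p, map_add' := fun _ _ => rfl, map_smul' := fun _ _ => rfl }
    refine exists_tangentVector_of_derivation (D := ev ∘ₗ π.bracket.flip f) fun g h => ?_
    exact DFunLike.congr_fun (π.leibniz g h f) p
  exact ⟨fun p => (h p).choose, fun p => (h p).choose_spec⟩

/-- Near `p` the chart components of `X` are the brackets `{u i, f}` with `u i` extending the
coordinates, and brackets are smooth by definition. -/
theorem IsHamiltonianField.contMDiff {π : PoissonStructure m M} {f : C^∞⟮𝓡 m, M; ℝ⟯}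
    {X : ∀ p : M, TangentSpace (𝓡 m) p} (hX : IsHamiltonianField π f X) :
    ContMDiff (𝓡 m) (𝓡 m).tangent ∞ (fun p => (⟨p, X p⟩ : TangentBundle (𝓡 m) M)) := by
  intro p
  have hu : ∀ i, ∃ u : C^∞⟮𝓡 m, M; ℝ⟯, u =ᶠ[𝓝 p] (fun y => y i) ∘ extChartAt (𝓡 m) p := fun i =>
    exists_contMDiffMap_chart (by fun_prop) p
  choose u hu using hu
  refine (Bundle.contMDiffAt_section (IB := 𝓡 m) (F := EuclideanSpace ℝ (Fin m))
    (E := TangentSpace (𝓡 m)) (s := X) p).2 ?_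
  have hs : ContMDiffAt (𝓡 m) 𝓘(ℝ, EuclideanSpace ℝ (Fin m)) ∞
      (fun q => (WithLp.toLp 2 fun i => π.bracket (u i) f q : EuclideanSpace ℝ (Fin m))) p := by
    have h : ContMDiff (𝓡 m) 𝓘(ℝ, Fin m → ℝ) ∞ fun q => fun i => π.bracket (u i) f q :=
      contMDiff_pi_space.2 fun i => (π.bracket (u i) f).contMDiff
    exact ((EuclideanSpace.equiv (Fin m) ℝ).symm.contDiff.contMDiff.comp h).contMDiffAt
  refine hs.congr_of_eventuallyEq ?_
  -- Equality of germs at each nearby `q` is needed, because derivatives at `q` are compared.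
  have hu' : ∀ᶠ q in 𝓝 p, ∀ i, u i =ᶠ[𝓝 q] (fun y => y i) ∘ extChartAt (𝓡 m) p :=
    eventually_all.2 fun i => (hu i).eventuallyEq_nhds
  filter_upwards [hu', extChartAt_source_mem_nhds (I := 𝓡 m) p] with q hq hqs
  have hqs' : q ∈ (chartAt (EuclideanSpace ℝ (Fin m)) p).source := by simpa using hqs
  have : IsManifold (𝓡 m) 1 M := IsManifold.of_le (n := ∞) ENat.LEInfty.out
  have h₁ : (trivializationAt (EuclideanSpace ℝ (Fin m)) (TangentSpace (𝓡 m)) p ⟨q, X q⟩).2 =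
      dirDeriv (extChartAt (𝓡 m) p) q (X q) := by
    have h := DFunLike.congr_fun
      (TangentBundle.continuousLinearMapAt_trivializationAt (I := 𝓡 m) hqs') (X q)
    refine Eq.trans ?_ h
    rw [Bundle.Trivialization.continuousLinearMapAt_apply,
      Bundle.Trivialization.linearMapAt_apply, if_pos (by simpa using hqs')]
  rw [h₁]
  ext i
  have hd : MDifferentiableAt (𝓡 m) 𝓘(ℝ, EuclideanSpace ℝ (Fin m)) (extChartAt (𝓡 m) p) q :=
    mdifferentiableAt_extChartAt hqs'
  have h₂ := (hX q (u i)).symm.trans (DFunLike.congr_fun (hq i).mfderiv_eq (X q))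
  have h₃ := mfderiv_comp q ((EuclideanSpace.proj (𝕜 := ℝ) i :
    EuclideanSpace ℝ (Fin m) →L[ℝ] ℝ).differentiableAt.mdifferentiableAt) hd
  have h₄ := DFunLike.congr_fun h₃ (X q)
  refine Eq.trans ?_ (h₂.trans h₄).symm
  rw [mfderiv_eq_fderiv, ContinuousLinearMap.fderiv]
  rfl

end HamiltonianFields

end PoissonGeometry

namespace PoissonGeometry

/-! ### Curvature of the Levi-Civita connection -/

section Curvature

variable {m n : ℕ} {M : Type*} [TopologicalSpace M] [ChartedSpace (EuclideanSpace ℝ (Fin m)) M]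

theorem dirDeriv_mul {f g : M → ℂ} {p : M} (hf : MDifferentiableAt (𝓡 m) 𝓘(ℝ, ℂ) f p)
    (hg : MDifferentiableAt (𝓡 m) 𝓘(ℝ, ℂ) g p) (v : TangentSpace (𝓡 m) p) :
    dirDeriv (fun q => f q * g q) p v = dirDeriv f p v * g p + f p * dirDeriv g p v := by
  have h := DFunLike.congr_fun (hf.hasMFDerivAt.mul hg.hasMFDerivAt).mfderiv v
  refine Eq.trans h ?_
  rw [mul_comm (dirDeriv f p v), add_comm]
  rfl

theorem dirDeriv_sum {ι : Type} [Fintype ι] {f : ι → M → ℂ} {p : M}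
    (hf : ∀ i, MDifferentiableAt (𝓡 m) 𝓘(ℝ, ℂ) (f i) p) (v : TangentSpace (𝓡 m) p) :
    dirDeriv (fun q => ∑ i, f i q) p v = ∑ i, dirDeriv (f i) p v := by
  have h : HasMFDerivAt (𝓡 m) 𝓘(ℝ, ℂ) (∑ i, f i) p
      (∑ i, (mfderiv (𝓡 m) 𝓘(ℝ, ℂ) (f i) p : EuclideanSpace ℝ (Fin m) →L[ℝ] ℂ)) := by
    refine HasMFDerivAt.sum (I := 𝓡 m) (E' := ℂ) (z := p) (t := Finset.univ) (f := f) ?_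
    exact fun i _ => (hf i).hasMFDerivAt
  have e : (fun q => ∑ i, f i q) = ∑ i, f i := by
    ext q
    simp
  rw [e]
  refine Eq.trans (DFunLike.congr_fun h.mfderiv v) ?_
  exact sum_apply _ _ _

variable [IsManifold (𝓡 m) ∞ M]

/-- The function is the fibre component of the tangent map of `f` composed with the section `X`. -/
theorem mdifferentiable_dirDeriv {F : Type*} [NormedAddCommGroup F] [NormedSpace ℝ F] {f : M → F}
    (hf : ContMDiff (𝓡 m) 𝓘(ℝ, F) ∞ f) {X : ∀ q : M, TangentSpace (𝓡 m) q}
    (hX : ContMDiff (𝓡 m) (𝓡 m).tangent ∞ (fun p => (⟨p, X p⟩ : TangentBundle (𝓡 m) M))) :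
    MDifferentiable (𝓡 m) 𝓘(ℝ, F) fun q => dirDeriv f q (X q) := by
  have h := (hf.contMDiff_tangentMap (m := ∞) (by simp)).comp hX
  exact ((contMDiff_snd_tangentBundle_modelSpace F 𝓘(ℝ, F) (n := ∞)).comp h).mdifferentiable
    (by simp)

/-- The pointwise curvature `P (dP(v) dx(w) - dP(w) dx(v))` of the connection `P ∘ d`. -/
noncomputable def pointCurvature (P : Matrix (Fin n) (Fin n) C^∞⟮𝓡 m, M; 𝓘(ℝ, ℂ), ℂ⟯)
    (x : Fin n → C^∞⟮𝓡 m, M; 𝓘(ℝ, ℂ), ℂ⟯) (p : M) (v w : TangentSpace (𝓡 m) p) : Fin n → ℂ :=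
  (P.map fun a => a p) *ᵥ
    ((P.map fun a => dirDeriv a p v) *ᵥ (fun i => dirDeriv (x i) p w)
      - (P.map fun a => dirDeriv a p w) *ᵥ fun i => dirDeriv (x i) p v)

variable {P : Matrix (Fin n) (Fin n) C^∞⟮𝓡 m, M; 𝓘(ℝ, ℂ), ℂ⟯}

omit [IsManifold (𝓡 m) ∞ M] in
theorem IsProjectionMatrix.map_mul_map (hP : IsProjectionMatrix P) (p : M) :
    (P.map fun a => a p) * (P.map fun a => a p) = P.map fun a => a p := by
  have h := (ContMDiffMap.evalRingHom (I := 𝓡 m) (I' := 𝓘(ℝ, ℂ)) (R := ℂ) (n := ∞)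
    p).mapMatrix.map_mul P P
  rw [hP.idem] at h
  exact h.symm

/-- Product rule for `P · dx(Y)`; the `P` in front of the second derivatives is absorbed by
idempotence. -/
theorem leviCivita_leviCivita (hP : IsProjectionMatrix P) {X Y : ∀ p : M, TangentSpace (𝓡 m) p}
    (hY : ContMDiff (𝓡 m) (𝓡 m).tangent ∞ (fun p => (⟨p, Y p⟩ : TangentBundle (𝓡 m) M)))
    (x : Sections P) (p : M) :
    leviCivita P X (leviCivita P Y (sectionFun x)) p =
      (P.map fun a => a p) *ᵥ
        ((P.map fun a => dirDeriv a p (X p)) *ᵥ (fun i => dirDeriv (x.1 i) p (Y p))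
          + fun i => dirDeriv (fun q => dirDeriv (x.1 i) q (Y q)) p (X p)) := by
  have hYx : ∀ i, MDifferentiable (𝓡 m) 𝓘(ℝ, ℂ) fun q => dirDeriv (x.1 i) q (Y q) := fun i =>
    mdifferentiable_dirDeriv (x.1 i).contMDiff hY
  have hPd : ∀ i j, MDifferentiable (𝓡 m) 𝓘(ℝ, ℂ) (P i j) := fun i j => (P i j).mdifferentiable
  have h : (fun i => dirDeriv (fun q => leviCivita P Y (sectionFun x) q i) p (X p)) =
      (P.map fun a => dirDeriv a p (X p)) *ᵥ (fun i => dirDeriv (x.1 i) p (Y p))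
      + (P.map fun a => a p) *ᵥ
        fun i => dirDeriv (fun q => dirDeriv (x.1 i) q (Y q)) p (X p) := by
    ext i
    have e : (fun q => leviCivita P Y (sectionFun x) q i) =
        fun q => ∑ j, P i j q * dirDeriv (x.1 j) q (Y q) := rfl
    rw [e, dirDeriv_sum (f := fun j q => P i j q * dirDeriv (x.1 j) q (Y q))
      fun j => (hPd i j p).mul (hYx j p)]
    simp only [dirDeriv_mul (hPd i _ p) (hYx _ p), Finset.sum_add_distrib]
    rfl
  have h' : leviCivita P X (leviCivita P Y (sectionFun x)) p = (P.map fun a => a p) *ᵥ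
      fun i => dirDeriv (fun q => leviCivita P Y (sectionFun x) q i) p (X p) := rfl
  rw [h', h, Matrix.mulVec_add, Matrix.mulVec_add, Matrix.mulVec_mulVec (M := P.map fun a => a p)
    (N := P.map fun a => a p), hP.map_mul_map]

/-- The curvature of the connection `P ∘ d` is tensorial. -/
theorem curvature_eq_pointCurvature (hP : IsProjectionMatrix P)
    {X Y : ∀ p : M, TangentSpace (𝓡 m) p}
    (hX : ContMDiff (𝓡 m) (𝓡 m).tangent ∞ (fun p => (⟨p, X p⟩ : TangentBundle (𝓡 m) M)))
    (hY : ContMDiff (𝓡 m) (𝓡 m).tangent ∞ (fun p => (⟨p, Y p⟩ : TangentBundle (𝓡 m) M)))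
    (x : Sections P) (p : M) :
    curvature P X Y (sectionFun x) p = pointCurvature P x.1 p (X p) (Y p) := by
  have hbr : leviCivita P (VectorField.mlieBracket (𝓡 m) X Y) (sectionFun x) p =
      (P.map fun a => a p) *ᵥ
        ((fun i => dirDeriv (fun q => dirDeriv (x.1 i) q (Y q)) p (X p))
          - fun i => dirDeriv (fun q => dirDeriv (x.1 i) q (X q)) p (Y p)) := by
    refine congrArg ((P.map fun a => a p) *ᵥ ·) (funext fun i => ?_)
    -- The bracket term consists of exactly the second derivatives left by the two iterated
    -- covariant derivatives.
    exact dirDeriv_mlieBracket (x.1 i).contMDiff hX hY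
      (mdifferentiable_dirDeriv (x.1 i).contMDiff hX)
      (mdifferentiable_dirDeriv (x.1 i).contMDiff hY) p
  rw [curvature, Pi.sub_apply, Pi.sub_apply, leviCivita_leviCivita hP hY,
    leviCivita_leviCivita hP hX, hbr, pointCurvature]
  simp only [Matrix.mulVec_add, Matrix.mulVec_sub]
  abel

variable {π : PoissonStructure m M}

omit [IsManifold (𝓡 m) ∞ M] in
theorem dirDeriv_re_im (F : C^∞⟮𝓡 m, M; 𝓘(ℝ, ℂ), ℂ⟯) (p : M) (v : TangentSpace (𝓡 m) p) :
    dirDeriv F p v = ⟨dirDeriv (reMap F) p v, dirDeriv (imMap F) p v⟩ := by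
  have hF : MDifferentiableAt (𝓡 m) 𝓘(ℝ, ℂ) F p := F.mdifferentiableAt
  have h (A : ℂ →L[ℝ] ℝ) : dirDeriv (A ∘ F) p v = A (dirDeriv F p v) := by
    have h₁ := mfderiv_comp p A.differentiableAt.mdifferentiableAt hF
    refine Eq.trans (DFunLike.congr_fun h₁ v) ?_
    rw [mfderiv_eq_fderiv, ContinuousLinearMap.fderiv]
    rfl
  exact Complex.ext (h Complex.reCLM).symm (h Complex.imCLM).symm

omit [IsManifold (𝓡 m) ∞ M] in
theorem IsHamiltonianVector.dirDeriv_eq {f : C^∞⟮𝓡 m, M; ℝ⟯} {p : M}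
    {v : TangentSpace (𝓡 m) p} (hv : IsHamiltonianVector π f p v)
    (F : C^∞⟮𝓡 m, M; 𝓘(ℝ, ℂ), ℂ⟯) :
    π.complexify.bracket F (mkMap f 0) p = dirDeriv F p v := by
  rw [dirDeriv_re_im]
  refine Eq.trans ?_ (congrArg₂ Complex.mk (hv (reMap F)) (hv (imMap F))).symm
  simp [PoissonBracket.complexify]

omit [IsManifold (𝓡 m) ∞ M] in
/-- At values of Hamiltonian vector fields, the curvature of the connection is the algebraic
curvature of the bracket. -/
theorem bracketCurvature_apply {f g : C^∞⟮𝓡 m, M; ℝ⟯} {p : M} {v w : TangentSpace (𝓡 m) p}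
    (hv : IsHamiltonianVector π f p v) (hw : IsHamiltonianVector π g p w)
    (x : Fin n → C^∞⟮𝓡 m, M; 𝓘(ℝ, ℂ), ℂ⟯) :
    (fun i => bracketCurvature π.complexify P (mkMap f 0) (mkMap g 0) x i p) =
      pointCurvature P x p v w := by
  let ev := ContMDiffMap.evalRingHom (I := 𝓡 m) (I' := 𝓘(ℝ, ℂ)) (R := ℂ) (n := ∞) p
  have hev : ∀ a : C^∞⟮𝓡 m, M; 𝓘(ℝ, ℂ), ℂ⟯, a p = ev a := fun _ => rfl
  have hmul : ∀ (Q : Matrix (Fin n) (Fin n) C^∞⟮𝓡 m, M; 𝓘(ℝ, ℂ), ℂ⟯)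
      (y : Fin n → C^∞⟮𝓡 m, M; 𝓘(ℝ, ℂ), ℂ⟯),
      (fun i => ev ((Q *ᵥ y) i)) = Q.map ev *ᵥ fun i => ev (y i) := fun Q y =>
    funext fun i => RingHom.map_mulVec ev Q y i
  simp only [pointCurvature, ← hv.dirDeriv_eq, ← hw.dirDeriv_eq, hev, bracketCurvature]
  rw [hmul]
  congr 1
  simp only [Pi.sub_apply, map_sub]
  exact congrArg₂ (· - ·) (hmul _ _) (hmul _ _)

end Curvature

end PoissonGeometry

/-! ### The equivalence -/

open PoissonGeometry in
theorem mainTheorem11 {m : ℕ} {M : Type*} [TopologicalSpace M] [T2Space M]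
    [SecondCountableTopology M] [ChartedSpace (EuclideanSpace ℝ (Fin m)) M]
    [IsManifold (𝓡 m) ∞ M] (π : PoissonStructure m M) {n : ℕ}
    (P : Matrix (Fin n) (Fin n) C^∞⟮𝓡 m, M; 𝓘(ℝ, ℂ), ℂ⟯) (hP : IsProjectionMatrix P) :
    IsPoissonModule π.complexify (sectionBracket π P) ↔
      ∀ L : Set M, IsSymplecticLeaf π L → IsFlatOnLeaf π P L := by
  rw [isPoissonModule_iff π hP]
  constructor
  · intro h L _ X Y hX hY x p hp
    obtain ⟨f, hf⟩ := hX.tangent p hp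
    obtain ⟨g, hg⟩ := hY.tangent p hp
    rw [curvature_eq_pointCurvature hP hX.smooth hY.smooth, ← bracketCurvature_apply hf hg, h]
    rfl
  · intro h a b x
    refine bracketCurvature_eq_zero_of_real π x.1 (fun f g => ?_) a b
    obtain ⟨X, hX⟩ := exists_isHamiltonianField π f
    obtain ⟨Y, hY⟩ := exists_isHamiltonianField π g
    ext i p
    -- Flatness is used on the leaf through `p` itself; Hamiltonian fields are tangent to every
    -- leaf.
    have hp := h _ ⟨p, rfl⟩ X Y ⟨hX.contMDiff, fun q _ => ⟨f, hX q⟩⟩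
      ⟨hY.contMDiff, fun q _ => ⟨g, hY q⟩⟩ x p (Relation.EqvGen.refl p)
    rw [curvature_eq_pointCurvature hP hX.contMDiff hY.contMDiff,
      ← bracketCurvature_apply (hX p) (hY p)] at hp
    exact congrFun hp i
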